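/- Let $L\ge 3$ be an integer and let $\phi:\mathbb R\to\mathbb R$ be continuous with $\phi(t)=0$ for all $t\notin[0,L]$ and with $\phi\not\equiv 0$ on $(i,i+1)$ for each $i=0,1,\dots,L-1$. Let $$\mathcal S(\phi)=\Big\{\sum_{k\in\mathbb Z}c_k\phi(\cdot-k):\ c_k\in\mathbb C\Big\}.$$ For $A\subset\mathbb R$, a function $f\in\mathcal S(\phi)$ is called locally conjugate phase retrievable on $A$ if for every $g\in\mathcal S(\phi)$ with $|g(x)|=|f(x)|$ for all $x\in A$ there is $z\in\mathbb C$, $|z|=1$, such that $g=zf$ on $A$ or $g=z\overline f$ on $A$; $\mathcal S(\phi)$ is locally conjugate phase retrievable on $A$ if all its members are; and $f$ is conjugate phase retrievable if this holds with $A=\mathbb R$. Assume that for every $j\in\mathbb Z$ the space $\mathcal S(\phi)$ is locally conjugate phase retrievable on $I_j=(j,j+1)$, and that $\phi$ is locally linearly independent on $I_j$: if $\sum_k c_k\phi(x-k)=0$ for all $x\in I_j$, then $c_k=0$ for every $k$ with $\phi(\cdot-k)\not\equiv0$ on $I_j$. Let $f=\sum_{k\in\mathbb Z}c_k\phi(\cdot-k)\in\mathcal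 S(\phi)$ be nonzero. With values in $\mathbb Z\cup\{\pm\infty\}$ and the conventions $\sup\emptyset=-\infty$, $\inf\emptyset=+\infty$, put $$K_-=\inf\{k: c_k\ne0\},\qquad K_+=\sup\{k: c_k\neq 0\},$$ $$\kappa_-=\sup\{k:\ \exists\,\xi\in\mathbb C,\ |\xi|=1,\ \operatorname{Im}(\overline{\xi}c_l)=0\ \text{for all } l\le k\},$$ $$\kappa_+=\inf\{k>\kappa_-:\ \exists\,\xi\in\mathbb C,\ |\xi|=1,\ \operatorname{Im}(\overline{\xi}c_l)=0\ \text{for all } l\ge k\},$$ and $\mathcal K(f)=(\kappa_-,\kappa_+)\cap\mathbb Z$. Then $f$ is conjugate phase retrievable if and only if both of the following hold: (i) $\displaystyle\sum_{l=0}^{L-2}|c_{k+l}|\neq 0$ for all integers $k$ with $K_--L+1<k<K_++1$; (ii) if $\mathcal K(f)\neq\emptyset$, then $\displaystyle\sum_{k-L+2\le n_1<n_2\le k}|\operatorname{Im}(c_{n_1}\overline{c_{n_2}})|\ne0$ for all integers $k$ with $\kappa_-+1\le k\le\kappa_++L-3$. -/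

import Mathlib

noncomputable section

namespace ConjPhase

open scoped ComplexConjugate

/-- The function `x ↦ ∑_{k ∈ ℤ} c_k φ(x - k)`. For a compactly supported `φ` only finitely many
terms are nonzero at each `x`, so the finite sum is the honest value of the series. -/
def shiftSum (φ : ℝ → ℝ) (c : ℤ → ℂ) : ℝ → ℂ :=
  fun x => ∑ᶠ k : ℤ, c k * (φ (x - (k : ℝ)) : ℂ)

/-- The complex shift-invariant space `S(φ)`, with arbitrary complex coefficient sequences. -/
def shiftInvariantSpace (φ : ℝ → ℝ) : Set (ℝ → ℂ) :=
  Set.range (shiftSum φ)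

/-- `f` is locally conjugate phase retrievable on `A` within `S(φ)`. -/
def LocallyConjPhaseRetrievable (φ : ℝ → ℝ) (A : Set ℝ) (f : ℝ → ℂ) : Prop :=
  ∀ g ∈ shiftInvariantSpace φ, (∀ x ∈ A, ‖f x‖ = ‖g x‖) →
    ∃ z : ℂ, ‖z‖ = 1 ∧ ((∀ x ∈ A, g x = z * f x) ∨ (∀ x ∈ A, g x = z * conj (f x)))

/-- The space `S(φ)` is locally conjugate phase retrievable on `A`: all its members are. -/
def SpaceLocallyConjPhaseRetrievable (φ : ℝ → ℝ) (A : Set ℝ) : Prop :=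
  ∀ f ∈ shiftInvariantSpace φ, LocallyConjPhaseRetrievable φ A f

/-- `f` is (globally) conjugate phase retrievable in `S(φ)`. -/
def ConjPhaseRetrievable (φ : ℝ → ℝ) (f : ℝ → ℂ) : Prop :=
  LocallyConjPhaseRetrievable φ Set.univ f

/-- Local linear independence of the integer translates of `φ` on `A`: if `∑ c_k φ(x - k)`
vanishes on `A`, then `c_k = 0` for every `k` such that `φ(· - k)` is not identically zero on
`A`. -/
def LocallyLinearlyIndependent (φ : ℝ → ℝ) (A : Set ℝ) : Prop :=
  ∀ c : ℤ → ℂ, (∀ x ∈ A, shiftSum φ c x = 0) →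
    ∀ k : ℤ, (∃ x ∈ A, φ (x - (k : ℝ)) ≠ 0) → c k = 0

/-- `K₋ = inf {k : c_k ≠ 0}`, in `ℤ ∪ {±∞}` viewed inside the extended reals. -/
def kMinus (c : ℤ → ℂ) : EReal :=
  sInf {x : EReal | ∃ k : ℤ, c k ≠ 0 ∧ x = ((k : ℝ) : EReal)}

/-- `K₊ = sup {k : c_k ≠ 0}`. -/
def kPlus (c : ℤ → ℂ) : EReal :=
  sSup {x : EReal | ∃ k : ℤ, c k ≠ 0 ∧ x = ((k : ℝ) : EReal)}

/-- `κ₋ = sup {k : there is a unimodular ξ with Im (ξ̄ c_l) = 0 for all l ≤ k}`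
(with `sup ∅ = -∞`): the end of the longest initial part that is real up to a unimodular
constant. -/
def kappaMinus (c : ℤ → ℂ) : EReal :=
  sSup {x : EReal | ∃ k : ℤ,
    (∃ ξ : ℂ, ‖ξ‖ = 1 ∧ ∀ l : ℤ, l ≤ k → (conj ξ * c l).im = 0) ∧ x = ((k : ℝ) : EReal)}

/-- `κ₊ = inf {k > κ₋ : there is a unimodular ξ with Im (ξ̄ c_l) = 0 for all l ≥ k}`
(with `inf ∅ = +∞`). -/
def kappaPlus (c : ℤ → ℂ) : EReal :=
  sInf {x : EReal | ∃ k : ℤ, kappaMinus c < ((k : ℝ) : EReal) ∧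
    (∃ ξ : ℂ, ‖ξ‖ = 1 ∧ ∀ l : ℤ, k ≤ l → (conj ξ * c l).im = 0) ∧ x = ((k : ℝ) : EReal)}

/-- The index set `𝒦 = (κ₋, κ₊) ∩ ℤ` of the complex middle part. -/
def middleIndices (c : ℤ → ℂ) : Set ℤ :=
  {k : ℤ | kappaMinus c < ((k : ℝ) : EReal) ∧ ((k : ℝ) : EReal) < kappaPlus c}

end ConjPhase

end

/-!
The restriction of `∑ c_k φ(· - k)` to `(j, j + 1)` only involves the window of coefficients
`c_{j-L+1}, …, c_j`, and it determines them by local linear independence. Hence `|f| = |g|` holds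
on the line if and only if on every window of length `L` the coefficients `d` of `g` are either
`z c` or `z c̄` for a unimodular `z` depending on the window (`ConjEquivOn`), and `f` is conjugate
phase retrievable if and only if such windowwise equivalence implies equivalence on all of `ℤ`
(`Rigid`, `conjPhaseRetrievable_iff_rigid`). What remains is a question about sequences.

Consecutive windows overlap in `L - 1` indices. If `c` vanishes on such an overlap but on neither
side of it, the part of `c` on the right can be multiplied by an arbitrary phase; this is (i). If `c`
is real up to a phase `ξ` on an overlap (`RealOn`), then `c = ξ² c̄` there, so `c` on the left can be
glued to `ξ² c̄` on the right. The result is equivalent to `c` only if `c` is real up to a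
phase on the whole left or on the whole right part (`Rigid.realOn_Iic_or_realOn_Ici`); in the range
of (ii) neither is the case if there is a middle part.

Conversely, whether `d` is `z c` or `z c̄` is decided on every window on which `c` is not real up to
a phase, and the decision is the same on two consecutive windows if `c` is not real on their overlap.
By (ii), or by the structure of `c` when there is no middle part, all overlaps between two nonreal
windows are nonreal (`not_realOn_overlap`), so one alternative holds on all windows. By (i) the
phases of successive windows then agree (`exists_phase_of_windows`).
-/

namespace ConjPhase

open scoped ComplexConjugate

/-- The sequence `c` is real on `S` up to a unimodular constant. -/
def RealOn (c : ℤ → ℂ) (S : Set ℤ) : Prop :=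
  ∃ ξ : ℂ, ‖ξ‖ = 1 ∧ ∀ l ∈ S, (conj ξ * c l).im = 0

/-- On `S`, the sequence `d` is a unimodular multiple of `c` or of its conjugate. -/
def ConjEquivOn (c d : ℤ → ℂ) (S : Set ℤ) : Prop :=
  ∃ z : ℂ, ‖z‖ = 1 ∧ ((∀ l ∈ S, d l = z * c l) ∨ (∀ l ∈ S, d l = z * conj (c l)))

/-- Every sequence equivalent to `c` on all windows of `L` consecutive integers is equivalent to
`c` on `ℤ`. -/
def Rigid (L : ℤ) (c : ℤ → ℂ) : Prop :=
  ∀ d : ℤ → ℂ, (∀ j : ℤ, ConjEquivOn c d (Set.Icc (j - L + 1) j)) → ConjEquivOn c d Set.univ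

/-- Between nonzero entries of `c` there are no `L - 1` consecutive zeros. Being on the left or on
the right of the block is expressed by half-lines containing it. -/
def NoLongGap (L : ℤ) (c : ℤ → ℂ) : Prop :=
  ∀ k : ℤ, (∃ m ≤ k + L - 2, c m ≠ 0) → (∃ n ≥ k, c n ≠ 0) →
    ∃ l ∈ Set.Icc k (k + L - 2), c l ≠ 0

/-! ### Sequences that are real up to a phase -/

lemma RealOn.mono {c : ℤ → ℂ} {S T : Set ℤ} (h : RealOn c T) (hST : S ⊆ T) : RealOn c S := by
  obtain ⟨ξ, h1, h2⟩ := h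
  exact ⟨ξ, h1, fun l hl => h2 l (hST hl)⟩

lemma conj_mul_self_of_norm {ξ : ℂ} (h : ‖ξ‖ = 1) : conj ξ * ξ = 1 := by
  rw [Complex.conj_mul', h]; norm_num

lemma im_conj_mul_eq_zero_iff {ξ a : ℂ} (h : ‖ξ‖ = 1) :
    (conj ξ * a).im = 0 ↔ a = ξ ^ 2 * conj a := by
  have h1 := conj_mul_self_of_norm h
  rw [← Complex.conj_eq_iff_im]
  simp only [map_mul, Complex.conj_conj]
  constructor
  · intro h2
    linear_combination (-ξ) * h2 - a * h1
  · intro h2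
    linear_combination (-conj ξ) * h2 - ξ * conj a * h1

lemma realOn_of_eq_mul_conj {c : ℤ → ℂ} {S : Set ℤ} {w : ℂ} (hw : ‖w‖ = 1)
    (h : ∀ l ∈ S, c l = w * conj (c l)) : RealOn c S := by
  obtain ⟨ξ, rfl⟩ := IsAlgClosed.exists_pow_nat_eq w two_pos
  have hξ : ‖ξ‖ = 1 := by
    rw [norm_pow] at hw
    exact (pow_eq_one_iff_of_nonneg (norm_nonneg _) two_ne_zero).1 hw
  exact ⟨ξ, hξ, fun l hl => (im_conj_mul_eq_zero_iff hξ).2 (h l hl)⟩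

lemma im_mul_conj_eq_zero {ξ a b : ℂ} (h : ‖ξ‖ = 1) (ha : (conj ξ * a).im = 0)
    (hb : (conj ξ * b).im = 0) : (a * conj b).im = 0 := by
  have h1 := conj_mul_self_of_norm h
  rw [← Complex.conj_eq_iff_im] at *
  simp only [map_mul, Complex.conj_conj] at *
  linear_combination (-conj a * b + a * conj b) * h1 + conj ξ * b * ha - conj ξ * a * hb

lemma realOn_of_ne_zero {c : ℤ → ℂ} {S : Set ℤ} {m : ℤ} (hm : c m ≠ 0)
    (h : ∀ n ∈ S, (c n * conj (c m)).im = 0) : RealOn c S := by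
  have hn : ‖c m‖ ≠ 0 := norm_ne_zero_iff.2 hm
  refine ⟨c m / (‖c m‖ : ℂ), by simp [hn], fun l hl => ?_⟩
  have : conj (c m / (‖c m‖ : ℂ)) * c l = ((‖c m‖⁻¹ : ℝ) : ℂ) * (c l * conj (c m)) := by
    rw [map_div₀, Complex.conj_ofReal]; push_cast; ring
  rw [this, Complex.im_ofReal_mul, h l hl, mul_zero]

lemma realOn_iff {c : ℤ → ℂ} {S : Set ℤ} :
    RealOn c S ↔ ∀ m ∈ S, ∀ n ∈ S, (c m * conj (c n)).im = 0 := by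
  constructor
  · rintro ⟨ξ, h, h'⟩ m hm n hn
    exact im_mul_conj_eq_zero h (h' m hm) (h' n hn)
  · intro h
    by_cases h0 : ∃ m ∈ S, c m ≠ 0
    · obtain ⟨m, hm, hm0⟩ := h0
      exact realOn_of_ne_zero hm0 fun n hn => h n hn m hm
    · push Not at h0
      exact ⟨1, by simp, fun l hl => by simp [h0 l hl]⟩

lemma RealOn.union {c : ℤ → ℂ} {S T : Set ℤ} {m : ℤ} (hS : RealOn c S) (hT : RealOn c T)
    (hmS : m ∈ S) (hmT : m ∈ T) (hm : c m ≠ 0) : RealOn c (S ∪ T) := by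
  refine realOn_of_ne_zero hm ?_
  rintro n (hn | hn)
  · exact realOn_iff.1 hS n hn m hmS
  · exact realOn_iff.1 hT n hn m hmT

lemma sum_abs_im_ne_zero_iff (c : ℤ → ℂ) (a b : ℤ) :
    ∑ n₁ ∈ Finset.Icc a b, ∑ n₂ ∈ Finset.Ioc n₁ b, |(c n₁ * conj (c n₂)).im| ≠ 0 ↔
      ¬ RealOn c (Set.Icc a b) := by
  rw [not_iff_not, Finset.sum_eq_zero_iff_of_nonneg
    (fun _ _ => Finset.sum_nonneg fun _ _ => abs_nonneg _), realOn_iff]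
  have key : ∀ m n : ℤ, (c m * conj (c n)).im = -(c n * conj (c m)).im := fun m n => by
    rw [← Complex.conj_im]; simp [mul_comm]
  constructor
  · intro h m hm n hn
    have h' : ∀ m ∈ Set.Icc a b, ∀ n ∈ Set.Icc a b, m < n → (c m * conj (c n)).im = 0 := by
      intro m hm n hn hmn
      have := (Finset.sum_eq_zero_iff_of_nonneg (fun _ _ => abs_nonneg _)).1
        (h m (Finset.mem_Icc.2 hm)) n (Finset.mem_Ioc.2 ⟨hmn, hn.2⟩)
      simpa using this
    rcases lt_trichotomy m n with hmn | rfl | hmn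
    · exact h' m hm n hn hmn
    · rw [Complex.mul_conj, Complex.ofReal_im]
    · rw [key, h' n hn m hm hmn, neg_zero]
  · intro h m hm
    refine Finset.sum_eq_zero fun n hn => ?_
    rw [Finset.mem_Icc] at hm
    rw [Finset.mem_Ioc] at hn
    rw [h m hm n ⟨by omega, hn.2⟩, abs_zero]

/-! ### The extremal indices -/

lemma lt_coe_add_iff (x : EReal) (r s : ℝ) :
    ((s : ℝ) : EReal) < x + (r : EReal) ↔ ((s - r : ℝ) : EReal) < x := by
  induction x with
  | bot => simp
  | top => exact iff_of_true (by simp) (EReal.coe_lt_top _)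
  | coe x => norm_cast; constructor <;> intro h <;> linarith

lemma add_coe_lt_iff (x : EReal) (r s : ℝ) :
    x + (r : EReal) < ((s : ℝ) : EReal) ↔ x < ((s - r : ℝ) : EReal) := by
  induction x with
  | bot => exact iff_of_true (by simp) (EReal.bot_lt_coe _)
  | top => simp
  | coe x => norm_cast; constructor <;> intro h <;> linarith

/-- Whether an integer is at most the supremum of a lower set `P` of integers is decided by `P`, and
otherwise the supremum is smaller by at least one. -/
lemma sSup_le_pred_or_le_sSup {P : ℤ → Prop} (hP : ∀ k l : ℤ, l ≤ k → P k → P l) (k : ℤ) :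
    (sSup {x : EReal | ∃ k : ℤ, P k ∧ x = ((k : ℝ) : EReal)} ≤ (((k - 1 : ℤ) : ℝ) : EReal) ∧ ¬ P k) ∨
    ((((k : ℤ) : ℝ) : EReal) ≤ sSup {x : EReal | ∃ k : ℤ, P k ∧ x = ((k : ℝ) : EReal)} ∧ P k) := by
  by_cases h : P k
  · exact Or.inr ⟨le_sSup ⟨k, h, rfl⟩, h⟩
  · refine Or.inl ⟨sSup_le ?_, h⟩
    rintro _ ⟨m, hm, rfl⟩
    have : m ≤ k - 1 := by
      by_contra hmk
      exact h (hP m k (by omega) hm)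
    exact_mod_cast this

lemma succ_le_sInf_or_sInf_le {P : ℤ → Prop} (hP : ∀ k l : ℤ, k ≤ l → P k → P l) (k : ℤ) :
    ((((k + 1 : ℤ) : ℝ) : EReal) ≤ sInf {x : EReal | ∃ k : ℤ, P k ∧ x = ((k : ℝ) : EReal)} ∧ ¬ P k) ∨
    (sInf {x : EReal | ∃ k : ℤ, P k ∧ x = ((k : ℝ) : EReal)} ≤ (((k : ℤ) : ℝ) : EReal) ∧ P k) := by
  by_cases h : P k
  · exact Or.inr ⟨sInf_le ⟨k, h, rfl⟩, h⟩
  · refine Or.inl ⟨le_sInf ?_, h⟩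
    rintro _ ⟨m, hm, rfl⟩
    have : k + 1 ≤ m := by
      by_contra hmk
      exact h (hP m k (by omega) hm)
    exact_mod_cast this

lemma coe_pred_lt (k : ℤ) : (((k - 1 : ℤ) : ℝ) : EReal) < ((k : ℝ) : EReal) := by
  exact_mod_cast (by omega : k - 1 < k)

lemma kappaMinus_dichotomy (c : ℤ → ℂ) (k : ℤ) :
    (kappaMinus c ≤ (((k - 1 : ℤ) : ℝ) : EReal) ∧ ¬ RealOn c (Set.Iic k)) ∨
    (((k : ℝ) : EReal) ≤ kappaMinus c ∧ RealOn c (Set.Iic k)) :=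
  sSup_le_pred_or_le_sSup (P := fun k => RealOn c (Set.Iic k))
    (fun _ _ h hk => hk.mono (Set.Iic_subset_Iic.2 h)) k

lemma kappaMinus_lt_iff (c : ℤ → ℂ) (k : ℤ) :
    kappaMinus c < ((k : ℝ) : EReal) ↔ ¬ RealOn c (Set.Iic k) := by
  rcases kappaMinus_dichotomy c k with ⟨h1, h2⟩ | ⟨h1, h2⟩
  · exact iff_of_true (h1.trans_lt (coe_pred_lt k)) h2
  · exact iff_of_false h1.not_gt (not_not.2 h2)

lemma kappaMinus_add_one_le_iff (c : ℤ → ℂ) (k : ℤ) :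
    kappaMinus c + 1 ≤ ((k : ℝ) : EReal) ↔ ¬ RealOn c (Set.Iic k) := by
  rw [← not_lt, ← EReal.coe_one, lt_coe_add_iff, not_lt]
  have e : (((k : ℝ) - 1 : ℝ) : EReal) = (((k - 1 : ℤ) : ℝ) : EReal) := by push_cast; rfl
  rw [e]
  rcases kappaMinus_dichotomy c k with ⟨h1, h2⟩ | ⟨h1, h2⟩
  · exact iff_of_true h1 h2
  · exact iff_of_false ((coe_pred_lt k).trans_le h1).not_ge (not_not.2 h2)

lemma kappaPlus_dichotomy (c : ℤ → ℂ) (k : ℤ) :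
    ((((k + 1 : ℤ) : ℝ) : EReal) ≤ kappaPlus c ∧
      ¬ (¬ RealOn c (Set.Iic k) ∧ RealOn c (Set.Ici k))) ∨
    (kappaPlus c ≤ ((k : ℝ) : EReal) ∧ ¬ RealOn c (Set.Iic k) ∧ RealOn c (Set.Ici k)) := by
  have e : kappaPlus c = sInf {x : EReal | ∃ k : ℤ,
      (¬ RealOn c (Set.Iic k) ∧ RealOn c (Set.Ici k)) ∧ x = ((k : ℝ) : EReal)} := by
    simp only [kappaPlus, kappaMinus_lt_iff, and_assoc]
    rfl
  rw [e]
  refine succ_le_sInf_or_sInf_le (P := fun k => ¬ RealOn c (Set.Iic k) ∧ RealOn c (Set.Ici k)) ?_ k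
  exact fun _ _ h hk => ⟨fun h' => hk.1 (h'.mono (Set.Iic_subset_Iic.2 h)),
    hk.2.mono (Set.Ici_subset_Ici.2 h)⟩

lemma lt_kappaPlus_iff (c : ℤ → ℂ) (k : ℤ) :
    ((k : ℝ) : EReal) < kappaPlus c ↔ RealOn c (Set.Iic k) ∨ ¬ RealOn c (Set.Ici k) := by
  rcases kappaPlus_dichotomy c k with ⟨h1, h2⟩ | ⟨h1, h2⟩
  · have := (coe_pred_lt (k + 1)).trans_le h1
    rw [add_sub_cancel_right] at this
    exact iff_of_true this (by tauto)
  · exact iff_of_false h1.not_gt (by tauto)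

lemma le_kappaPlus_add_iff (c : ℤ → ℂ) (L k : ℤ) :
    ((k : ℝ) : EReal) ≤ kappaPlus c + ((L : ℝ) : EReal) - 3 ↔
      RealOn c (Set.Iic (k - L + 2)) ∨ ¬ RealOn c (Set.Ici (k - L + 2)) := by
  have e3 : (-3 : EReal) = ((-3 : ℝ) : EReal) := by rw [EReal.coe_neg]; rfl
  rw [sub_eq_add_neg, e3, ← not_lt, add_coe_lt_iff, add_coe_lt_iff, not_lt]
  have e : (((k : ℝ) - (-3) - (L : ℝ) : ℝ) : EReal) = (((k - L + 2 + 1 : ℤ) : ℝ) : EReal) := by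
    congr 1; push_cast; ring
  rw [e]
  rcases kappaPlus_dichotomy c (k - L + 2) with ⟨h1, h2⟩ | ⟨h1, h2⟩
  · exact iff_of_true h1 (by tauto)
  · refine iff_of_false (h1.trans_lt ?_).not_ge (by tauto)
    have := coe_pred_lt (k - L + 2 + 1)
    rwa [add_sub_cancel_right] at this

lemma middleIndices_nonempty_iff (c : ℤ → ℂ) :
    (middleIndices c).Nonempty ↔ ∃ k, ¬ RealOn c (Set.Iic k) ∧ ¬ RealOn c (Set.Ici k) := by
  refine exists_congr fun k => ?_
  simp only [middleIndices, Set.mem_ofPred_eq, kappaMinus_lt_iff, lt_kappaPlus_iff]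
  tauto

lemma kMinus_lt_iff (c : ℤ → ℂ) (L k : ℤ) :
    kMinus c - ((L : ℝ) : EReal) + 1 < ((k : ℝ) : EReal) ↔ ∃ m ≤ k + L - 2, c m ≠ 0 := by
  rw [sub_eq_add_neg, ← EReal.coe_neg, ← EReal.coe_one, add_coe_lt_iff, add_coe_lt_iff, kMinus,
    sInf_lt_iff]
  constructor
  · rintro ⟨_, ⟨m, hm, rfl⟩, h⟩
    refine ⟨m, ?_, hm⟩
    have h' : m < k - 1 - -L := by exact_mod_cast h
    omega
  · rintro ⟨m, h, hm⟩
    refine ⟨_, ⟨m, hm, rfl⟩, ?_⟩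
    have h' : m < k - 1 - -L := by omega
    exact_mod_cast h'

lemma lt_kPlus_add_one_iff (c : ℤ → ℂ) (k : ℤ) :
    ((k : ℝ) : EReal) < kPlus c + 1 ↔ ∃ n ≥ k, c n ≠ 0 := by
  rw [← EReal.coe_one, lt_coe_add_iff, kPlus, lt_sSup_iff]
  constructor
  · rintro ⟨_, ⟨m, hm, rfl⟩, h⟩
    refine ⟨m, ?_, hm⟩
    have h' : k - 1 < m := by exact_mod_cast h
    omega
  · rintro ⟨m, h, hm⟩
    refine ⟨_, ⟨m, hm, rfl⟩, ?_⟩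
    have h' : k - 1 < m := by omega
    exact_mod_cast h'

lemma sum_norm_ne_zero_iff (c : ℤ → ℂ) (L k : ℤ) :
    ∑ l ∈ Finset.Icc (0 : ℤ) (L - 2), ‖c (k + l)‖ ≠ 0 ↔
      ∃ l ∈ Set.Icc k (k + L - 2), c l ≠ 0 := by
  rw [Ne, Finset.sum_eq_zero_iff_of_nonneg fun _ _ => norm_nonneg _]
  push Not
  constructor
  · rintro ⟨l, hl, h⟩
    rw [Finset.mem_Icc] at hl
    exact ⟨k + l, ⟨by omega, by omega⟩, norm_ne_zero_iff.1 h⟩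
  · rintro ⟨l, hl, h⟩
    refine ⟨l - k, Finset.mem_Icc.2 ⟨by linarith [hl.1], by linarith [hl.2]⟩, ?_⟩
    rw [add_sub_cancel]
    exact norm_ne_zero_iff.2 h

/-! ### Necessity of the two conditions -/

lemma Rigid.noLongGap {L : ℤ} {c : ℤ → ℂ} (h : Rigid L c) : NoLongGap L c := by
  rintro k ⟨m, hm, hm0⟩ ⟨n, hn, hn0⟩
  by_contra! hgap
  have hmk : m < k := by
    by_contra hmk
    exact hm0 (hgap m ⟨by omega, hm⟩)
  have hkn : k + L - 2 < n := by
    by_contra hkn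
    exact hn0 (hgap n ⟨hn, by omega⟩)
  have cm0 : conj (c m) ≠ 0 := (map_ne_zero _).2 hm0
  -- The phase must avoid the trivial one and the one that turns `c` into a multiple of `c̄`.
  obtain ⟨z, hz, hz1, hz2⟩ : ∃ z : ℂ, ‖z‖ = 1 ∧ z ≠ 1 ∧
      z ≠ c m / conj (c m) * conj (c n) / c n := by
    by_cases h1 : (-1 : ℂ) = c m / conj (c m) * conj (c n) / c n
    · refine ⟨Complex.I, by simp, ?_, ?_⟩
      · intro h; simpa using congrArg Complex.re h
      · rw [← h1]; intro h; simpa using congrArg Complex.re h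
    · exact ⟨-1, by simp, by norm_num, h1⟩
  obtain ⟨w, -, hw | hw⟩ := h (fun l => if l < k then c l else z * c l) (by
    intro j
    by_cases hj : j - L + 1 < k
    · refine ⟨1, by simp, Or.inl fun l hl => ?_⟩
      dsimp only
      split_ifs with hlk
      · rw [one_mul]
      · rw [hgap l ⟨by omega, by have := hl.2; have := hl.1; omega⟩]; simp
    · refine ⟨z, hz, Or.inl fun l hl => ?_⟩
      have := hl.1
      exact if_neg (by omega))
  · have h1 := hw m trivial
    have h2 := hw n trivial
    simp only [if_pos hmk, if_neg (by omega : ¬ n < k)] at h1 h2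
    have hw1 : w = 1 := mul_right_cancel₀ hm0 (by rw [← h1, one_mul])
    exact hz1 (by rw [mul_right_cancel₀ hn0 h2, hw1])
  · have h1 := hw m trivial
    have h2 := hw n trivial
    simp only [if_pos hmk, if_neg (by omega : ¬ n < k)] at h1 h2
    apply hz2
    have hw1 : c m / conj (c m) = w := (div_eq_iff cm0).2 h1
    rw [hw1, ← h2]; field_simp

/-- If `c` is real up to a phase on an overlap of two consecutive windows, rigidity forces it to be
so on the whole half-line on one side of the overlap, the overlap included. -/
lemma Rigid.realOn_Iic_or_realOn_Ici {L : ℤ} {c : ℤ → ℂ} (h : Rigid L c) {k : ℤ}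
    (hk : RealOn c (Set.Icc (k - L + 2) k)) :
    RealOn c (Set.Iic k) ∨ RealOn c (Set.Ici (k - L + 2)) := by
  obtain ⟨ξ, hξ, hreal⟩ := hk
  have hξ2 : ‖ξ ^ 2‖ = 1 := by rw [norm_pow, hξ, one_pow]
  have hov : ∀ l, k - L + 2 ≤ l → l ≤ k → c l = ξ ^ 2 * conj (c l) := fun l h1 h2 =>
    (im_conj_mul_eq_zero_iff hξ).1 (hreal l ⟨h1, h2⟩)
  obtain ⟨w, hw, hd | hd⟩ := h (fun l => if l ≤ k then c l else ξ ^ 2 * conj (c l)) (by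
    intro j
    by_cases hj : j ≤ k
    · refine ⟨1, by simp, Or.inl fun l hl => ?_⟩
      exact (if_pos (hl.2.trans hj)).trans (one_mul _).symm
    · refine ⟨ξ ^ 2, hξ2, Or.inr fun l hl => ?_⟩
      dsimp only
      split_ifs with hlk
      · exact hov l (by have := hl.1; omega) hlk
      · rfl)
  · by_cases h0 : ∃ m ≤ k, c m ≠ 0
    · obtain ⟨m, hm, hm0⟩ := h0
      have h1 := hd m trivial
      dsimp only at h1
      rw [if_pos hm] at h1
      have hw1 : w = 1 := mul_right_cancel₀ hm0 (by rw [← h1, one_mul])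
      refine Or.inr (realOn_of_eq_mul_conj hξ2 fun l hl => ?_)
      by_cases hlk : l ≤ k
      · exact hov l hl hlk
      · have h2 := hd l trivial
        dsimp only at h2
        rw [if_neg hlk, hw1, one_mul] at h2
        exact h2.symm
    · push Not at h0
      exact Or.inl ⟨1, by simp, fun l hl => by simp [h0 l hl]⟩
  · refine Or.inl (realOn_of_eq_mul_conj hw fun l hl => ?_)
    have h1 := hd l trivial
    dsimp only at h1
    rwa [if_pos (show l ≤ k from hl)] at h1

/-! ### Sufficiency of the two conditions -/

lemma eq_mul_of_windows_of_ge {L : ℤ} (hL : 2 ≤ L) {c d : ℤ → ℂ} (hgap : NoLongGap L c)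
    (hwin : ∀ j : ℤ, ∃ z : ℂ, ∀ l ∈ Set.Icc (j - L + 1) j, d l = z * c l)
    {n₀ : ℤ} (h0 : c n₀ ≠ 0) {z : ℂ} (hz : d n₀ = z * c n₀) (m : ℕ) :
    d (n₀ + m) = z * c (n₀ + m) := by
  induction m using Nat.strong_induction_on with
  | _ m ih =>
    rcases Nat.eq_zero_or_pos m with rfl | hm
    · simpa using hz
    obtain ⟨z', hz'⟩ := hwin (n₀ + m)
    by_cases hex : ∃ i : ℕ, i < m ∧ n₀ + m - L + 1 ≤ n₀ + i ∧ c (n₀ + i) ≠ 0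
    · obtain ⟨i, him, hiL, hi0⟩ := hex
      have h1 := hz' (n₀ + i) ⟨hiL, by omega⟩
      rw [ih i him] at h1
      rw [mul_right_cancel₀ hi0 h1]
      exact hz' _ ⟨by omega, le_rfl⟩
    · -- All earlier entries of the window vanish, so the gap condition makes the last one vanish.
      push Not at hex
      have hlt : n₀ < n₀ + m - L + 1 := by
        by_contra hle
        exact h0 (by simpa using hex 0 hm (by push_cast; omega))
      have hcm : c (n₀ + m) = 0 := by
        by_contra hne
        obtain ⟨l, hl, hl0⟩ := hgap (n₀ + m - L + 1) ⟨n₀, by omega, h0⟩ ⟨n₀ + m, by omega, hne⟩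
        obtain ⟨i, hi⟩ := Int.eq_ofNat_of_zero_le (show 0 ≤ l - n₀ by have := hl.1; omega)
        have hli : l = n₀ + i := by omega
        subst hli
        have h1 := hl.1
        have h2 := hl.2
        exact hl0 (hex i (by omega) h1)
      rw [hz' _ ⟨by omega, le_rfl⟩, hcm, mul_zero, mul_zero]

lemma exists_phase_of_windows {L : ℤ} (hL : 2 ≤ L) {c d : ℤ → ℂ} (hgap : NoLongGap L c)
    (hc : ∃ n, c n ≠ 0)
    (hwin : ∀ j : ℤ, ∃ z : ℂ, ‖z‖ = 1 ∧ ∀ l ∈ Set.Icc (j - L + 1) j, d l = z * c l) :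
    ∃ z : ℂ, ‖z‖ = 1 ∧ ∀ l, d l = z * c l := by
  obtain ⟨n₀, h0⟩ := hc
  obtain ⟨z, hz1, hz⟩ := hwin n₀
  have hzn := hz n₀ ⟨by omega, le_rfl⟩
  refine ⟨z, hz1, fun l => ?_⟩
  rcases le_total n₀ l with hl | hl
  · obtain ⟨m, rfl⟩ := Int.le.dest hl
    exact eq_mul_of_windows_of_ge hL hgap (fun j => (hwin j).imp fun _ h => h.2) h0 hzn m
  · obtain ⟨m, hm⟩ := Int.le.dest hl
    -- The indices below `n₀` are treated by reflection.
    have := eq_mul_of_windows_of_ge (c := fun i => c (-i)) (d := fun i => d (-i)) (n₀ := -n₀)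
      hL ?_ ?_ (by simpa using h0) (by simpa using hzn) m
    · have e : -(-n₀ + (m : ℤ)) = l := by omega
      simpa only [e] using this
    · rintro k ⟨p, hp, hp0⟩ ⟨q, hq, hq0⟩
      obtain ⟨i, hi, hi0⟩ := hgap (-k - L + 2) ⟨-q, by omega, hq0⟩ ⟨-p, by omega, hp0⟩
      exact ⟨-i, ⟨by have := hi.2; omega, by have := hi.1; omega⟩, by simpa using hi0⟩
    · intro j
      obtain ⟨w, -, hw⟩ := hwin (-j + L - 1)
      exact ⟨w, fun i hi => hw (-i) ⟨by have := hi.2; omega, by have := hi.1; omega⟩⟩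

/-- Any overlap located between two nonreal windows is nonreal. If `c` has no middle part, it
consists of a real left part and a real right part (for different phases), and the reason is that an
overlap between nonreal windows contains the first, nonzero, entry of the right part. -/
lemma not_realOn_overlap {L : ℤ} {c : ℤ → ℂ}
    (hmid : (∃ k, ¬ RealOn c (Set.Iic k) ∧ ¬ RealOn c (Set.Ici k)) →
      ∀ k, ¬ RealOn c (Set.Iic k) → ¬ RealOn c (Set.Ici (k - L + 2)) →
        ¬ RealOn c (Set.Icc (k - L + 2) k))
    {j₁ j₂ k : ℤ} (h₁ : ¬ RealOn c (Set.Icc (j₁ - L + 1) j₁))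
    (h₂ : ¬ RealOn c (Set.Icc (j₂ - L + 1) j₂)) (hk₁ : j₁ ≤ k) (hk₂ : k < j₂) :
    ¬ RealOn c (Set.Icc (k - L + 2) k) := by
  have hl : ¬ RealOn c (Set.Iic j₁) := fun h => h₁ (h.mono fun l hl => hl.2)
  have hr : ¬ RealOn c (Set.Ici (j₂ - L + 1)) := fun h => h₂ (h.mono fun l hl => hl.1)
  by_cases hne : ∃ k, ¬ RealOn c (Set.Iic k) ∧ ¬ RealOn c (Set.Ici k)
  · exact hmid hne k (fun h => hl (h.mono (Set.Iic_subset_Iic.2 hk₁)))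
      fun h => hr (h.mono (Set.Ici_subset_Ici.2 (by omega)))
  push Not at hne
  have hl' : RealOn c (Set.Iic (j₂ - L + 1)) := by
    by_contra h
    exact hr (hne _ h)
  obtain ⟨p, hp, hpmax⟩ := Int.exists_greatest_of_bdd
    (P := fun q => RealOn c (Set.Iic q)) ⟨j₁, fun q hq => by
      by_contra hlt
      exact hl (hq.mono (Set.Iic_subset_Iic.2 (by omega)))⟩ ⟨_, hl'⟩
  have hp1 : ¬ RealOn c (Set.Iic (p + 1)) := fun h => by have := hpmax _ h; omega
  have hpj₂ := hpmax _ hl'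
  have hpj₁ : p < j₁ := by
    by_contra hlt
    exact hl (hp.mono (Set.Iic_subset_Iic.2 (by omega)))
  have hc0 : c (p + 1) ≠ 0 := by
    intro h0
    obtain ⟨ξ, hξ, h⟩ := hp
    refine hp1 ⟨ξ, hξ, fun l hl => ?_⟩
    rcases (show l ≤ p + 1 from hl).eq_or_lt with rfl | hlt
    · simp [h0]
    · exact h l (Int.lt_add_one_iff.1 hlt)
  intro hreal
  refine h₂ ((hreal.union (hne _ hp1) (m := p + 1) ⟨by omega, by omega⟩
    (Set.mem_Ici.2 le_rfl) hc0).mono fun l hl => ?_)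
  rcases le_or_gt l k with hlk | hlk
  · exact Or.inl ⟨by have := hl.1; omega, hlk⟩
  · exact Or.inr (show p + 1 ≤ l by omega)

lemma rigid_of_conditions {L : ℤ} (hL : 2 ≤ L) {c : ℤ → ℂ} (hc : ∃ n, c n ≠ 0)
    (hgap : NoLongGap L c)
    (hmid : (∃ k, ¬ RealOn c (Set.Iic k) ∧ ¬ RealOn c (Set.Ici k)) →
      ∀ k, ¬ RealOn c (Set.Iic k) → ¬ RealOn c (Set.Ici (k - L + 2)) →
        ¬ RealOn c (Set.Icc (k - L + 2) k)) : Rigid L c := by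
  intro d hd
  -- `A` and `B` are the windows on which `d` is a multiple of `c` and of `c̄`, respectively.
  let A : ℤ → Prop := fun j => ∃ z : ℂ, ‖z‖ = 1 ∧ ∀ l ∈ Set.Icc (j - L + 1) j, d l = z * c l
  let B : ℤ → Prop :=
    fun j => ∃ z : ℂ, ‖z‖ = 1 ∧ ∀ l ∈ Set.Icc (j - L + 1) j, d l = z * conj (c l)
  have hAB : ∀ j, A j ∨ B j := by
    intro j
    obtain ⟨z, hz, h | h⟩ := hd j
    · exact Or.inl ⟨z, hz, h⟩
    · exact Or.inr ⟨z, hz, h⟩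
  have hreal : ∀ i j (S : Set ℤ), A i → B j → S ⊆ Set.Icc (i - L + 1) i →
      S ⊆ Set.Icc (j - L + 1) j → RealOn c S := by
    rintro i j S ⟨z, hz, h⟩ ⟨w, hw, h'⟩ hi hj
    have hz0 : z ≠ 0 := norm_ne_zero_iff.1 (by rw [hz]; exact one_ne_zero)
    refine realOn_of_eq_mul_conj (w := w / z) (by rw [norm_div, hz, hw, div_one]) fun l hl => ?_
    have := (h l (hi hl)).symm.trans (h' l (hj hl))
    field_simp
    rw [mul_comm, this]
  have hboth : ∀ j, RealOn c (Set.Icc (j - L + 1) j) → A j ∧ B j := by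
    rintro j ⟨ξ, hξ, h⟩
    have hov := fun l hl => (im_conj_mul_eq_zero_iff hξ).1 (h l hl)
    have h1 := conj_mul_self_of_norm hξ
    rcases hAB j with hA | hB
    · refine ⟨hA, ?_⟩
      obtain ⟨z, hz, h⟩ := hA
      refine ⟨z * ξ ^ 2, by rw [norm_mul, norm_pow, hz, hξ]; norm_num, fun l hl => ?_⟩
      rw [h l hl, mul_assoc, ← hov l hl]
    · refine ⟨?_, hB⟩
      obtain ⟨z, hz, h⟩ := hB
      refine ⟨z * conj ξ ^ 2, by rw [norm_mul, norm_pow, RCLike.norm_conj, hz, hξ]; norm_num,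
        fun l hl => ?_⟩
      rw [h l hl]
      linear_combination (-z * conj ξ ^ 2) * hov l hl - (z * conj (c l) * (conj ξ * ξ + 1)) * h1
  have hprop : ∀ j₁ j₂, ¬ RealOn c (Set.Icc (j₁ - L + 1) j₁) →
      ¬ RealOn c (Set.Icc (j₂ - L + 1) j₂) → j₁ ≤ j₂ → (A j₁ ↔ A j₂) := by
    intro j₁ j₂ h₁ h₂ hle
    have : ∀ n, j₁ ≤ n → n ≤ j₂ → (A j₁ ↔ A n) := by
      intro n hn
      induction n, hn using Int.leInduction with
      | base => exact fun _ => Iff.rfl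
      | succ n hn ih =>
        intro hn2
        rw [ih (by omega)]
        have hO := not_realOn_overlap hmid h₁ h₂ hn (by omega : n < j₂)
        have s1 : Set.Icc (n - L + 2) n ⊆ Set.Icc (n - L + 1) n :=
          Set.Icc_subset_Icc (by omega) le_rfl
        have s2 : Set.Icc (n - L + 2) n ⊆ Set.Icc (n + 1 - L + 1) (n + 1) :=
          Set.Icc_subset_Icc (by omega) (by omega)
        constructor
        · intro hA
          exact (hAB (n + 1)).resolve_right fun hB => hO (hreal n (n + 1) _ hA hB s1 s2)
        · intro hA
          exact (hAB n).resolve_right fun hB => hO (hreal (n + 1) n _ hA hB s2 s1)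
    exact this j₂ hle le_rfl
  have hall : (∀ j, A j) ∨ (∀ j, B j) := by
    by_contra! hcon
    obtain ⟨⟨i, hi⟩, j, hj⟩ := hcon
    have hAj : A j := (hAB j).resolve_right hj
    have ri : ¬ RealOn c (Set.Icc (i - L + 1) i) := fun h => hi (hboth i h).1
    have rj : ¬ RealOn c (Set.Icc (j - L + 1) j) := fun h => hj (hboth j h).2
    rcases le_total i j with h | h
    · exact hi ((hprop i j ri rj h).2 hAj)
    · exact hi ((hprop j i rj ri h).1 hAj)
  rcases hall with hA | hB
  · obtain ⟨z, hz, h⟩ := exists_phase_of_windows hL hgap hc hA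
    exact ⟨z, hz, Or.inl fun l _ => h l⟩
  · obtain ⟨z, hz, h⟩ := exists_phase_of_windows (c := fun l => conj (c l)) hL
      (by simpa only [NoLongGap, ne_eq, map_eq_zero] using hgap)
      (by simpa only [ne_eq, map_eq_zero] using hc) hB
    exact ⟨z, hz, Or.inr fun l _ => h l⟩

/-! ### From functions to coefficient sequences -/

/-- On the closed interval `[j, j + 1]`, only the translates by `j - L + 1, …, j` contribute; at the
end points this uses the continuity of `φ`. -/
lemma shiftSum_eq_sum {φ : ℝ → ℝ} {L : ℤ} (hφ : Continuous φ)
    (hsupp : ∀ t : ℝ, t ∉ Set.Icc (0 : ℝ) (L : ℝ) → φ t = 0) (c : ℤ → ℂ) {j : ℤ} {x : ℝ}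
    (hx : x ∈ Set.Icc (j : ℝ) ((j : ℝ) + 1)) :
    shiftSum φ c x = ∑ k ∈ Finset.Icc (j - L + 1) j, c k * (φ (x - (k : ℝ)) : ℂ) := by
  have hclosed : IsClosed {t | φ t = 0} := isClosed_eq hφ continuous_const
  have hle : ∀ t ≤ 0, φ t = 0 := by
    have : closure (Set.Iio (0 : ℝ)) ⊆ {t | φ t = 0} :=
      closure_minimal (fun t ht => hsupp t fun h => (not_le.2 ht) h.1) hclosed
    rw [closure_Iio] at this
    exact fun t ht => this ht
  have hge : ∀ t ≥ (L : ℝ), φ t = 0 := by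
    have : closure (Set.Ioi (L : ℝ)) ⊆ {t | φ t = 0} :=
      closure_minimal (fun t ht => hsupp t fun h => (not_le.2 ht) h.2) hclosed
    rw [closure_Ioi] at this
    exact fun t ht => this ht
  refine finsum_eq_sum_of_support_subset _ fun k hk => ?_
  by_contra hmem
  refine hk ?_
  suffices φ (x - k) = 0 by simp [this]
  simp only [Finset.coe_Icc, Set.mem_Icc, not_and_or, not_le] at hmem
  rcases hmem with h | h
  · apply hge
    have h' : ((k + L : ℤ) : ℝ) ≤ j := by exact_mod_cast (by omega : k + L ≤ j)
    push_cast at h'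
    linarith [hx.1]
  · apply hle
    have h' : ((j + 1 : ℤ) : ℝ) ≤ k := by exact_mod_cast h
    push_cast at h'
    linarith [hx.2]

lemma mem_Icc_floor (x : ℝ) : x ∈ Set.Icc ((⌊x⌋ : ℤ) : ℝ) (((⌊x⌋ : ℤ) : ℝ) + 1) :=
  ⟨Int.floor_le x, (Int.lt_floor_add_one x).le⟩

lemma shiftSum_eq_mul {φ : ℝ → ℝ} {L : ℤ} (hφ : Continuous φ)
    (hsupp : ∀ t : ℝ, t ∉ Set.Icc (0 : ℝ) (L : ℝ) → φ t = 0) {c d : ℤ → ℂ} {j : ℤ} {z : ℂ}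
    (h : ∀ l ∈ Set.Icc (j - L + 1) j, d l = z * c l) {x : ℝ}
    (hx : x ∈ Set.Icc (j : ℝ) ((j : ℝ) + 1)) : shiftSum φ d x = z * shiftSum φ c x := by
  rw [shiftSum_eq_sum hφ hsupp _ hx, shiftSum_eq_sum hφ hsupp _ hx, Finset.mul_sum]
  exact Finset.sum_congr rfl fun k hk => by rw [h k (Finset.mem_Icc.1 hk), mul_assoc]

lemma conj_shiftSum {φ : ℝ → ℝ} {L : ℤ} (hφ : Continuous φ)
    (hsupp : ∀ t : ℝ, t ∉ Set.Icc (0 : ℝ) (L : ℝ) → φ t = 0) (c : ℤ → ℂ) (x : ℝ) :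
    conj (shiftSum φ c x) = shiftSum φ (fun k => conj (c k)) x := by
  rw [shiftSum_eq_sum hφ hsupp c (mem_Icc_floor x), shiftSum_eq_sum hφ hsupp _ (mem_Icc_floor x),
    map_sum]
  simp

lemma coeff_eq_mul {φ : ℝ → ℝ} {L : ℤ} (hφ : Continuous φ)
    (hsupp : ∀ t : ℝ, t ∉ Set.Icc (0 : ℝ) (L : ℝ) → φ t = 0)
    (hne : ∀ i : ℤ, 0 ≤ i → i < L → ∃ t ∈ Set.Ioo (i : ℝ) ((i : ℝ) + 1), φ t ≠ 0) {j : ℤ}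
    (hindep : LocallyLinearlyIndependent φ (Set.Ioo (j : ℝ) ((j : ℝ) + 1))) {c d : ℤ → ℂ} {z : ℂ}
    (h : ∀ x ∈ Set.Ioo (j : ℝ) ((j : ℝ) + 1), shiftSum φ d x = z * shiftSum φ c x) :
    ∀ l ∈ Set.Icc (j - L + 1) j, d l = z * c l := by
  intro l hl
  refine sub_eq_zero.1 (hindep (fun k => d k - z * c k) (fun x hx => ?_) l ?_)
  · have h' := h x hx
    have hx' := Set.Ioo_subset_Icc_self hx
    rw [shiftSum_eq_sum hφ hsupp _ hx', shiftSum_eq_sum hφ hsupp _ hx', Finset.mul_sum] at h'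
    rw [shiftSum_eq_sum hφ hsupp _ hx', ← sub_eq_zero.2 h', ← Finset.sum_sub_distrib]
    exact Finset.sum_congr rfl fun k _ => by ring
  · obtain ⟨t, ht, ht0⟩ := hne (j - l) (by linarith [hl.2]) (by linarith [hl.1])
    push_cast at ht
    exact ⟨t + l, ⟨by linarith [ht.1], by linarith [ht.2]⟩, by rwa [add_sub_cancel_right]⟩

/-- The local hypotheses turn conjugate phase retrieval into a property of the coefficients. -/
theorem conjPhaseRetrievable_iff_rigid {φ : ℝ → ℝ} {L : ℤ} (hφ : Continuous φ) (hL : 1 ≤ L)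
    (hsupp : ∀ t : ℝ, t ∉ Set.Icc (0 : ℝ) (L : ℝ) → φ t = 0)
    (hne : ∀ i : ℤ, 0 ≤ i → i < L → ∃ t ∈ Set.Ioo (i : ℝ) ((i : ℝ) + 1), φ t ≠ 0)
    (hindep : ∀ j : ℤ, LocallyLinearlyIndependent φ (Set.Ioo (j : ℝ) ((j : ℝ) + 1)))
    (hloc : ∀ j : ℤ, SpaceLocallyConjPhaseRetrievable φ (Set.Ioo (j : ℝ) ((j : ℝ) + 1)))
    (c : ℤ → ℂ) : ConjPhaseRetrievable φ (shiftSum φ c) ↔ Rigid L c := by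
  constructor
  · intro h d hd
    obtain ⟨z, hz, h | h⟩ := h (shiftSum φ d) ⟨d, rfl⟩ (fun x _ => by
      obtain ⟨z, hz, h | h⟩ := hd ⌊x⌋
      · rw [shiftSum_eq_mul hφ hsupp h (mem_Icc_floor x), norm_mul, hz, one_mul]
      · rw [shiftSum_eq_mul hφ hsupp (c := fun k => conj (c k)) h (mem_Icc_floor x), norm_mul, hz,
          one_mul, ← conj_shiftSum hφ hsupp, RCLike.norm_conj])
    · exact ⟨z, hz, Or.inl fun l _ => coeff_eq_mul hφ hsupp hne (hindep l)
        (fun x _ => h x trivial) l ⟨by omega, le_rfl⟩⟩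
    · exact ⟨z, hz, Or.inr fun l _ => coeff_eq_mul hφ hsupp hne (hindep l)
        (c := fun k => conj (c k))
        (fun x _ => by rw [h x trivial, conj_shiftSum hφ hsupp]) l ⟨by omega, le_rfl⟩⟩
  · rintro h _ ⟨d, rfl⟩ hnorm
    obtain ⟨z, hz, h | h⟩ := h d (fun j => by
      obtain ⟨z, hz, h | h⟩ := hloc j _ ⟨c, rfl⟩ _ ⟨d, rfl⟩ fun x _ => hnorm x trivial
      · exact ⟨z, hz, Or.inl (coeff_eq_mul hφ hsupp hne (hindep j) h)⟩
      · exact ⟨z, hz, Or.inr (coeff_eq_mul hφ hsupp hne (hindep j) (c := fun k => conj (c k))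
          fun x hx => by rw [h x hx, conj_shiftSum hφ hsupp])⟩)
    · exact ⟨z, hz, Or.inl fun x _ => shiftSum_eq_mul hφ hsupp (fun l _ => h l trivial)
        (mem_Icc_floor x)⟩
    · exact ⟨z, hz, Or.inr fun x _ => by
        rw [conj_shiftSum hφ hsupp]
        exact shiftSum_eq_mul hφ hsupp (c := fun k => conj (c k)) (fun l _ => h l trivial)
          (mem_Icc_floor x)⟩

end ConjPhase

open ConjPhase in
theorem mainTheorem1 (φ : ℝ → ℝ) (L : ℤ) (hφ : Continuous φ) (hL : 3 ≤ L)
    (hsupp : ∀ t : ℝ, t ∉ Set.Icc (0 : ℝ) (L : ℝ) → φ t = 0)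
    (hne : ∀ i : ℤ, 0 ≤ i → i < L → ∃ t ∈ Set.Ioo (i : ℝ) ((i : ℝ) + 1), φ t ≠ 0)
    (hindep : ∀ j : ℤ, LocallyLinearlyIndependent φ (Set.Ioo (j : ℝ) ((j : ℝ) + 1)))
    (hloc : ∀ j : ℤ, SpaceLocallyConjPhaseRetrievable φ (Set.Ioo (j : ℝ) ((j : ℝ) + 1)))
    (c : ℤ → ℂ) (f : ℝ → ℂ) (hf : f = shiftSum φ c) (hf0 : f ≠ 0) :
    ConjPhaseRetrievable φ f ↔
      (∀ k : ℤ, kMinus c - ((L : ℝ) : EReal) + 1 < ((k : ℝ) : EReal) →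
        ((k : ℝ) : EReal) < kPlus c + 1 →
        ∑ l ∈ Finset.Icc (0 : ℤ) (L - 2), ‖c (k + l)‖ ≠ 0) ∧
      ((middleIndices c).Nonempty →
        ∀ k : ℤ, kappaMinus c + 1 ≤ ((k : ℝ) : EReal) →
          ((k : ℝ) : EReal) ≤ kappaPlus c + ((L : ℝ) : EReal) - 3 →
          ∑ n₁ ∈ Finset.Icc (k - L + 2) k, ∑ n₂ ∈ Finset.Ioc n₁ k,
            |(c n₁ * (starRingEnd ℂ) (c n₂)).im| ≠ 0) := by
  have hc : ∃ n, c n ≠ 0 := by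
    by_contra! hc
    exact hf0 (by rw [hf]; funext x; simp [shiftSum, hc])
  rw [hf, conjPhaseRetrievable_iff_rigid hφ (by omega) hsupp hne hindep hloc]
  simp only [kMinus_lt_iff, lt_kPlus_add_one_iff, sum_norm_ne_zero_iff, middleIndices_nonempty_iff,
    kappaMinus_add_one_le_iff, le_kappaPlus_add_iff, sum_abs_im_ne_zero_iff]
  constructor
  · intro h
    refine ⟨h.noLongGap, ?_⟩
    rintro ⟨m, hm₁, hm₂⟩ k hk₁ hk₂ hreal
    have hr := (h.realOn_Iic_or_realOn_Ici hreal).resolve_left hk₁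
    have hl : RealOn c (Set.Iic (k - L + 2)) := hk₂.resolve_right (not_not.2 hr)
    -- The half-lines up to and from `k - L + 2` are both real, so there is no middle index.
    rcases le_total m (k - L + 2) with hmk | hmk
    · exact hm₁ (hl.mono (Set.Iic_subset_Iic.2 hmk))
    · exact hm₂ (hr.mono (Set.Ici_subset_Ici.2 hmk))
  · rintro ⟨hgap, hmid⟩
    exact rigid_of_conditions (by omega) hc hgap fun hne k hk₁ hk₂ => hmid hne k hk₁ (Or.inr hk₂)
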